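/- Let $\mathcal A,\mathcal E$ be finite sets and $P=P^{A,E}$ a probability distribution on $\mathcal A\times\mathcal E$, with $P^{A|E}(a|e)=P(a,e)/P^E(e)$; logarithms are natural. For $s\ge 0$ put $\tilde H_{1+s}(A|E)=-\log\sum_{a,e}P^E(e)P^{A|E}(a|e)^{1+s}$ and $H_{1+s}(A|E)=\tilde H_{1+s}(A|E)/s$ (equal to the Shannon conditional entropy $H(A|E)$ at $s=0$). For $0\le\epsilon<1$ let $$H_{\min}^{\epsilon}(A|E|P)=\max_{\Omega:\,P(\Omega)\ge 1-\epsilon}\ \min_{(a,e)\in\Omega}-\log P^{A|E}(a|e)$$ (points of probability $0$ count as $+\infty$), $\eta(x,a)=-x\log x+xa$, and, for real $M\ge 1$, $$\overline I_{\min,M}(A|E|P)=\inf_{0<\epsilon<1/4}\Big(M e^{-H_{\min}^{\epsilon}(A|E|P)}+2\,\eta\big(2\epsilon,\log(|\mathcal A|M)\big)\Big).$$ (i) For every integer $M\ge1$ and every random function $f_X:\mathcal A\to\{1,\dots,M\}$ that is universal$_2$ (that is, $\Pr[f_X(a_1)=f_X(a_2)]\le 1/M$ for all $a_1\ne a_2$),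 $\;\mathrm E_X I(f_X(A):E)\le\overline I_{\min,M}(A|E|P)$. (ii) Let $0\le R\le H(A|E)$ and let $P^n$ be the $n$-fold i.i.d. extension of $P$. Then $$\lim_{n\to\infty}\frac{-1}{n}\log\overline I_{\min,e^{nR}}(A|E|P^n)=\sup_{R'\ge R}\min\Big\{\sup_{s\ge0}\big(\tilde H_{1+s}(A|E)-sR'\big),\,R'-R\Big\}=\sup_{s\ge 0}\frac{s}{1+s}\big(H_{1+s}(A|E)-R\big)=:W .$$ If $R<H(A|E)$, then $W\le e_I(P|R)$, where $e_I(P|R)$ is the supremum of $\liminf_n\frac{-1}{n}\log I(f_n(A_n):E_n)$, $(A_n,E_n)\sim P^n$, over all sequences $f_n:\mathcal A^n\to\{1,\dots,M_n\}$ such that $\lim_n\frac1n\log M_n$ exists and is at least $R$, and $H(f_n(A_n))/\log M_n\to1$. (iii) In the situation of (ii), $W\le V:=\max_{0\le s\le1}s\,(H_{1+s}(A|E)-R)$, the exponent obtained from the Rényi entropy of order $1+s$. The inequality is strict if $R<H(A|E)$ and $P^{A|E}(a|e)$ is not constant on $\{(a,e):P(a,e)>0\}$. -/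

import Mathlib

open Filter Topology

noncomputable section

namespace SmoothMinEntropy

/-!
A joint distribution of `(A, E)` on finite alphabets is a function `P : A × E → ℝ` lying in
`stdSimplex ℝ (A × E)`. All logarithms are natural.
-/

/-- Marginal distribution `P^A`. -/
def margA {A E : Type*} [Fintype E] (P : A × E → ℝ) (a : A) : ℝ := ∑ e, P (a, e)

/-- Marginal distribution `P^E`. -/
def margE {A E : Type*} [Fintype A] (P : A × E → ℝ) (e : E) : ℝ := ∑ a, P (a, e)

/-- Conditional probability `P^{A|E}(a|e)` at `x = (a, e)`; it is used only where `P^E(e) > 0`, or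
with the weight `P^E(e)` or `P(a, e)`. -/
def condProb {A E : Type*} [Fintype A] (P : A × E → ℝ) (x : A × E) : ℝ := P x / margE P x.2

/-- Shannon entropy `-∑ p log p`. -/
def entropy {B : Type*} [Fintype B] (p : B → ℝ) : ℝ := ∑ b, Real.negMulLog (p b)

/-- Conditional Shannon entropy `H(A|E)`. -/
def condEntropy {A E : Type*} [Fintype A] [Fintype E] (P : A × E → ℝ) : ℝ :=
  -∑ x, P x * Real.log (condProb P x)

/-- Mutual information `I(A:E) = H(A) - H(A|E)`. -/
def mutualInfo {A E : Type*} [Fintype A] [Fintype E] (P : A × E → ℝ) : ℝ :=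
  entropy (margA P) - condEntropy P

/-- `H̃_{1+s}(A|E) = -log ∑_{a,e} P^E(e) P^{A|E}(a|e)^{1+s}`. -/
def renyiTilde {A E : Type*} [Fintype A] [Fintype E] (P : A × E → ℝ) (s : ℝ) : ℝ :=
  -Real.log (∑ x : A × E, margE P x.2 * condProb P x ^ (1 + s))

/-- Conditional Rényi entropy `H_{1+s}(A|E) = H̃_{1+s}(A|E) / s`, with the limiting value `H(A|E)`
at `s = 0`. -/
def condRenyi {A E : Type*} [Fintype A] [Fintype E] (P : A × E → ℝ) (s : ℝ) : ℝ :=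
  if s = 0 then condEntropy P else renyiTilde P s / s

/-- Smooth min-entropy
`H_min^ε(A|E) = max_{Ω : P(Ω) ≥ 1 - ε} min_{(a,e) ∈ Ω} -log P^{A|E}(a|e)` for `0 ≤ ε < 1`.
Points of probability zero count as `-log 0 = +∞`, so they do not affect the minimum. -/
def smoothMinEntropy {A E : Type*} [Fintype A] [Fintype E] (P : A × E → ℝ) (ε : ℝ) : ℝ :=
  sSup {h : ℝ | ∃ Ω : Finset (A × E), 1 - ε ≤ ∑ x ∈ Ω, P x ∧
    IsLeast ((fun x => -Real.log (condProb P x)) '' {x | x ∈ Ω ∧ 0 < P x}) h}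

/-- `η(x, a) = -x log x + x a`. -/
def eta (x a : ℝ) : ℝ := -x * Real.log x + x * a

/-- The leakage bound based on smooth min-entropy:
`inf_{0 < ε < 1/4} M e^{-H_min^ε(A|E)} + 2 η(2ε, log (|A| M))`. -/
def smoothLeakageBound {A E : Type*} [Fintype A] [Fintype E] (P : A × E → ℝ) (M : ℝ) : ℝ :=
  sInf ((fun ε => M * Real.exp (-smoothMinEntropy P ε)
    + 2 * eta (2 * ε) (Real.log (Fintype.card A * M))) '' Set.Ioo 0 (1 / 4))

/-- The `n`-fold i.i.d. extension of `P`. -/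
def iidDist {A E : Type*} (P : A × E → ℝ) (n : ℕ) : (Fin n → A) × (Fin n → E) → ℝ :=
  fun x => ∏ i, P (x.1 i, x.2 i)

/-- Joint distribution of `(f(A), E)`. -/
def hashDist {A E : Type*} [Fintype A] {M : ℕ} (P : A × E → ℝ) (f : A → Fin M) :
    Fin M × E → ℝ :=
  fun y => ∑ a with f a = y.1, P (a, y.2)

/-- A random function `f : A → {1, …, M}` with law `q` is universal₂: distinct points collide with
probability at most `1 / M`. -/
def IsUniversalTwo {A : Type*} [Fintype A] [DecidableEq A] {M : ℕ} (q : (A → Fin M) → ℝ) : Prop :=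
  q ∈ stdSimplex ℝ (A → Fin M) ∧
    ∀ a₁ a₂ : A, a₁ ≠ a₂ → ∑ f with f a₁ = f a₂, q f ≤ 1 / (M : ℝ)

/-- Expected information `E_X I(f_X(A) : E)` of Eve about the hashed value. -/
def expectedLeakage {A E : Type*} [Fintype A] [DecidableEq A] [Fintype E] {M : ℕ}
    (P : A × E → ℝ) (q : (A → Fin M) → ℝ) : ℝ :=
  ∑ f, q f * mutualInfo (hashDist P f)

/-- Optimal exponent of Eve's information at key rate `R`: the supremum of
`liminf -(1/n) log I(f_n(A_n) : E_n)` (with `-log 0 = +∞`) over the sequences of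
`f_n : A^n → {1, …, M_n}` whose rate `lim (1/n) log M_n` is at least `R` and whose output is
asymptotically uniform, `H(f_n(A_n)) / log M_n → 1`. -/
def leakageExponent {A E : Type*} [Fintype A] [Fintype E] (P : A × E → ℝ) (R : ℝ) : EReal :=
  sSup {x : EReal | ∃ (M : ℕ → ℕ) (f : ∀ n, (Fin n → A) → Fin (M n)) (r : ℝ),
    Tendsto (fun n => Real.log (M n) / n) atTop (𝓝 r) ∧ R ≤ r ∧
    Tendsto (fun n => entropy (margA (hashDist (iidDist P n) (f n))) / Real.log (M n))
      atTop (𝓝 1) ∧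
    x = liminf (fun n : ℕ =>
      -ENNReal.log (ENNReal.ofReal (mutualInfo (hashDist (iidDist P n) (f n)))) / (n : EReal))
      atTop}

end SmoothMinEntropy

end

/-! Write L = log P^{A|E}, a random variable under P. Then H̃_{1+s} = -log E[e^{sL}]
(`renyiTilde_eq`), so the exponents come from large deviations of i.i.d. sums of L.

(i) Since H(f(A)) ≤ log M, the leakage is at most log M - H(f(A)|E). Jensen and the collision bound
control its average by E[log(1 + M P^{A|E})]. On a near-optimal set Ω this is at most M
e^{-H_min^ε}; outside Ω it is at most ε log(1 + M), which the η term dominates.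

(ii) For P^n, smoothing to level nr costs the tail mass P^n(∑L ≥ -nr). Taking ε from Chernoff's
bound gives an upper estimate with the two exponents H̃_{1+s} - sr and r - R. Conversely, for each h
either the first term is at least M e^{-h} or ε is at least the tail at h
(`min_le_smoothLeakageBound`), and Cramér's lower bound (`eventually_le_upperTail`) makes this
tight. The two exponents agree at r = R + t with t = (H̃_{1+s} - sR)/(1+s), whence the formula for
W.

(iii) Jensen for x^{1/(1+s)} gives H̃_{1+s}/(1+s) ≤ H̃_{1+s/(1+s)}, and s/(1+s) stays in [0,1], so W
≤ V. Strictness at each s > 0 is not enough for a supremum over [0,∞); a linear bound on H̃ handles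
large s and compactness the rest. Finally W ≤ e_I because random hashing already attains V. -/

namespace SmoothMinEntropy

/-! ### Chernoff's bound and Cramér's lower bound -/

section ExponentialMoments

variable {ι : Type*} [Fintype ι]

/-- Exponential moment `∑ p exp (s L)` of `L` under the weights `p`. -/
noncomputable def expMoment (p L : ι → ℝ) (s : ℝ) : ℝ := ∑ x, p x * Real.exp (s * L x)

/-- Probability under the product weights `p^n` that the empirical mean of `L` is at least `t`. -/
noncomputable def upperTail (p L : ι → ℝ) (n : ℕ) (t : ℝ) : ℝ :=
  ∑ x : Fin n → ι with n * t ≤ ∑ i, L (x i), ∏ i, p (x i)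

lemma exists_pos_of_mem_stdSimplex {p : ι → ℝ} (hp : p ∈ stdSimplex ℝ ι) : ∃ x, 0 < p x := by
  by_contra! h
  have h1 := hp.2
  rw [Finset.sum_eq_zero fun x _ => le_antisymm (h x) (hp.1 x)] at h1
  exact zero_ne_one h1

lemma expMoment_pos {p : ι → ℝ} (hp : p ∈ stdSimplex ℝ ι) (L : ι → ℝ) (s : ℝ) :
    0 < expMoment p L s := by
  obtain ⟨x, hx⟩ := exists_pos_of_mem_stdSimplex hp
  exact Finset.sum_pos' (fun y _ => mul_nonneg (hp.1 y) (Real.exp_pos _).le)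
    ⟨x, Finset.mem_univ x, mul_pos hx (Real.exp_pos _)⟩

lemma expMoment_zero {p : ι → ℝ} (hp : p ∈ stdSimplex ℝ ι) (L : ι → ℝ) :
    expMoment p L 0 = 1 := by
  simp [expMoment, hp.2]

lemma hasDerivAt_expMoment (p L : ι → ℝ) (s : ℝ) :
    HasDerivAt (expMoment p L) (∑ x, p x * (Real.exp (s * L x) * L x)) s := by
  unfold expMoment
  refine HasDerivAt.fun_sum fun x _ => ?_
  exact (((hasDerivAt_id s).mul_const (L x)).exp.const_mul (p x)).congr_deriv (by simp)

lemma continuous_expMoment (p L : ι → ℝ) : Continuous (expMoment p L) := by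
  unfold expMoment
  fun_prop

lemma exists_gt_of_hasDerivAt_pos {f : ℝ → ℝ} {d a : ℝ} (hf : HasDerivAt f d a) (hd : 0 < d) :
    ∃ s, a < s ∧ s ≤ a + 1 ∧ f a < f s := by
  have h1 : Tendsto (slope f a) (𝓝[>] a) (𝓝 d) :=
    (hasDerivAt_iff_tendsto_slope.1 hf).mono_left
      (nhdsWithin_mono a fun x (hx : a < x) => hx.ne')
  have h2 : ∀ᶠ x in 𝓝[>] a, x ∈ Set.Ioo a (a + 1) := Ioo_mem_nhdsGT (by linarith)
  obtain ⟨s, hs, hs2⟩ := ((h1.eventually (lt_mem_nhds hd)).and h2).exists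
  refine ⟨s, hs2.1, hs2.2.le, ?_⟩
  rw [slope_def_field, div_pos_iff_of_pos_right (by linarith [hs2.1])] at hs
  linarith

lemma hasDerivAt_neg_log_expMoment_sub {p : ι → ℝ} (hp : p ∈ stdSimplex ℝ ι) (L : ι → ℝ)
    (r s : ℝ) :
    HasDerivAt (fun s => -Real.log (expMoment p L s) - s * r)
      (-((∑ x, p x * (Real.exp (s * L x) * L x)) / expMoment p L s) - r) s := by
  exact (((hasDerivAt_expMoment p L s).log (expMoment_pos hp L s).ne').fun_neg.fun_sub
    ((hasDerivAt_id' s).mul_const r)).congr_deriv (by simp)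

/-- If `r` lies below the mean of `-L`, then the Chernoff exponent at `r` is positive for some
small `s`. -/
lemma exists_neg_log_expMoment_pos {p : ι → ℝ} (hp : p ∈ stdSimplex ℝ ι) {L : ι → ℝ} {r : ℝ}
    (hr : r < -∑ x, p x * L x) :
    ∃ s, 0 < s ∧ s ≤ 1 ∧ 0 < -Real.log (expMoment p L s) - s * r := by
  obtain ⟨s, h0, h1, h2⟩ := exists_gt_of_hasDerivAt_pos
    (hasDerivAt_neg_log_expMoment_sub hp L r 0) (by simp [expMoment_zero hp]; linarith)
  refine ⟨s, h0, by linarith, ?_⟩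
  simpa [expMoment_zero hp] using h2

/-- Chernoff bound. -/
lemma upperTail_le {p : ι → ℝ} (hp : p ∈ stdSimplex ℝ ι) (L : ι → ℝ) (n : ℕ) (r : ℝ) {s : ℝ}
    (hs : 0 ≤ s) :
    upperTail p L n (-r) ≤ Real.exp (-(n * (-Real.log (expMoment p L s) - s * r))) := by
  -- The bound is the product expectation of exp(s ∑ (L + r)), a factor that is at least 1 on the
  -- tail event.
  have key : Real.exp (-(n * (-Real.log (expMoment p L s) - s * r)))
      = ∑ x : Fin n → ι, ∏ i, p (x i) * Real.exp (s * (L (x i) + r)) := by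
    rw [← Fintype.sum_pow (fun x => p x * Real.exp (s * (L x + r))), ← mul_neg, mul_comm,
      mul_comm _ (n : ℝ), Real.exp_nat_mul]
    congr 1
    rw [neg_sub, sub_neg_eq_add, add_comm, Real.exp_add, Real.exp_log (expMoment_pos hp L s),
      expMoment, Finset.sum_mul]
    refine Finset.sum_congr rfl fun x _ => ?_
    rw [mul_assoc, ← Real.exp_add, mul_add]
  rw [key, upperTail]
  have hpn : ∀ x : Fin n → ι, 0 ≤ ∏ i, p (x i) := fun x => Finset.prod_nonneg fun i _ => hp.1 _
  calc _ ≤ ∑ x : Fin n → ι with n * (-r) ≤ ∑ i, L (x i),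
        ∏ i, p (x i) * Real.exp (s * (L (x i) + r)) := by
        refine Finset.sum_le_sum fun x hx => ?_
        rw [Finset.prod_mul_distrib, ← Real.exp_sum, ← Finset.mul_sum, Finset.sum_add_distrib]
        refine le_mul_of_one_le_right (hpn x) (Real.one_le_exp (mul_nonneg hs ?_))
        have := (Finset.mem_filter.1 hx).2
        simp
        linarith
    _ ≤ _ := Finset.sum_le_sum_of_subset_of_nonneg (Finset.filter_subset _ _) fun x _ _ =>
        Finset.prod_nonneg fun i _ => mul_nonneg (hp.1 _) (Real.exp_pos _).le

/-- Weak law of large numbers with Chernoff's bound as its proof; it is applied to L and to -L under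
the tilted law. -/
lemma tendsto_upperTail_zero {p : ι → ℝ} (hp : p ∈ stdSimplex ℝ ι) {L : ι → ℝ} {t : ℝ}
    (ht : ∑ x, p x * L x < t) : Tendsto (fun n => upperTail p L n t) atTop (𝓝 0) := by
  obtain ⟨s, h0, -, hc⟩ := exists_neg_log_expMoment_pos hp (L := L) (r := -t) (by linarith)
  refine squeeze_zero (fun n => Finset.sum_nonneg fun x _ => Finset.prod_nonneg fun i _ => hp.1 _)
    (fun n => ?_) ?_ (g := fun n : ℕ =>
      Real.exp (-(n * (-Real.log (expMoment p L s) - s * (-t)))))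
  · simpa using upperTail_le hp L n (-t) h0.le
  · exact Real.tendsto_exp_neg_atTop_nhds_zero.comp
      (tendsto_natCast_atTop_atTop.atTop_mul_const hc)

/-- The function is 0 at s = 0 and negative beyond W/δ, so its maximum over [0, W/δ] is global on
[0,∞). -/
lemma exists_isMaxOn_neg_log_expMoment {p : ι → ℝ} (hp : p ∈ stdSimplex ℝ ι) {L : ι → ℝ}
    {r δ W : ℝ} (hδ : 0 < δ)
    (hW : ∀ s, 0 ≤ s → -Real.log (expMoment p L s) - s * r ≤ W - s * δ) :
    ∃ s, 0 ≤ s ∧ ∀ u, 0 ≤ u →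
      -Real.log (expMoment p L u) - u * r ≤ -Real.log (expMoment p L s) - s * r := by
  have hW0 : 0 ≤ W := by simpa [expMoment_zero hp] using hW 0 le_rfl
  have hb : 0 ≤ W / δ := by positivity
  have hc : Continuous fun s => -Real.log (expMoment p L s) - s * r :=
    ((continuous_expMoment p L).log fun s => (expMoment_pos hp L s).ne').neg.sub
      (continuous_id.mul continuous_const)
  obtain ⟨s, hs, hmax⟩ := isCompact_Icc.exists_isMaxOn (Set.nonempty_Icc.2 hb) hc.continuousOn
  refine ⟨s, hs.1, fun u hu => ?_⟩
  by_cases h : u ≤ W / δ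
  · exact hmax ⟨hu, h⟩
  · have h0 : (-Real.log (expMoment p L 0) - 0 * r) ≤ _ := hmax ⟨le_rfl, hb⟩
    have h1 := hW u hu
    rw [not_le, div_lt_iff₀ hδ] at h
    simp only [expMoment_zero hp, Real.log_one] at h0
    linarith

/-- Lower bound of Cramér's theorem for finitely supported weights. -/
lemma eventually_le_upperTail {p : ι → ℝ} (hp : p ∈ stdSimplex ℝ ι) {L : ι → ℝ}
    {r δ W : ℝ} (hδ : 0 < δ)
    (hW : ∀ s, 0 ≤ s → -Real.log (expMoment p L s) - s * r ≤ W - s * δ) :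
    ∀ᶠ n : ℕ in atTop, 1 / 2 * Real.exp (-(n * W)) ≤ upperTail p L n (-r) := by
  -- Optimising at r - δ/2 instead of r puts the tilted mean μ at least δ/2 above -r, so a window of
  -- radius δ/2 around μ stays inside the tail event.
  obtain ⟨s, hs, hmax⟩ := exists_isMaxOn_neg_log_expMoment hp (L := L) (r := r - δ / 2)
    (half_pos hδ) (W := W) fun s hs => by linarith [hW s hs]
  set Z := expMoment p L s with hZ
  have hZpos : 0 < Z := expMoment_pos hp L s
  set q : ι → ℝ := fun x => p x * Real.exp (s * L x) / Z with hq
  have hqs : q ∈ stdSimplex ℝ ι :=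
    ⟨fun x => div_nonneg (mul_nonneg (hp.1 x) (Real.exp_pos _).le) hZpos.le, by
      rw [← Finset.sum_div]; exact div_self hZpos.ne'⟩
  set μ := ∑ x, q x * L x with hμ
  have hder := hasDerivAt_neg_log_expMoment_sub hp L (r - δ / 2) s
  have hμ' : (∑ x, p x * (Real.exp (s * L x) * L x)) / expMoment p L s = μ := by
    rw [hμ, Finset.sum_div]
    refine Finset.sum_congr rfl fun x _ => ?_
    rw [hq, ← hZ]; ring
  rw [hμ'] at hder
  have hle : -μ - (r - δ / 2) ≤ 0 := by
    by_contra! h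
    obtain ⟨u, hu, -, hlt⟩ := exists_gt_of_hasDerivAt_pos hder h
    exact absurd (hmax u (hs.trans hu.le)) (not_le.2 hlt)
  -- Complementary slackness: either no tilt is needed, or the maximum is interior and μ = -(r -
  -- δ/2).
  have hcrit : s * (-μ - (r - δ / 2)) = 0 := by
    rcases hs.eq_or_lt with h | h
    · simp [← h]
    · have : IsLocalMax (fun s => -Real.log (expMoment p L s) - s * (r - δ / 2)) s := by
        filter_upwards [lt_mem_nhds h] with u hu using hmax u hu.le
      rw [this.hasDerivAt_eq_zero hder, mul_zero]
  have hup := tendsto_upperTail_zero hqs (L := L) (t := μ + δ / 2) (by linarith)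
  have hlo := tendsto_upperTail_zero hqs (L := fun x => -L x) (t := -μ + δ / 2)
    (by simp only [mul_neg, Finset.sum_neg_distrib]; linarith)
  have hlarge : ∀ᶠ n in atTop, upperTail q L n (μ + δ / 2)
      + upperTail q (fun x => -L x) n (-μ + δ / 2) < 1 / 2 := by
    refine (hup.add hlo).eventually (gt_mem_nhds ?_)
    norm_num
  filter_upwards [hlarge] with n hn
  have hqn : ∀ x : Fin n → ι, 0 ≤ ∏ i, q (x i) := fun x => Finset.prod_nonneg fun i _ => hqs.1 _
  have hpn : ∀ x : Fin n → ι, 0 ≤ ∏ i, p (x i) := fun x => Finset.prod_nonneg fun i _ => hp.1 _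
  have htot : ∑ x : Fin n → ι, ∏ i, q (x i) = 1 := by
    rw [← Fintype.sum_pow, hqs.2, one_pow]
  have hexp := hW s hs
  -- Change of measure: inside the window around μ, p^n ≥ e^{-nW} q^n; the last two terms cover the
  -- atypical sequences, whose total q^n-mass is below 1/2.
  have hpt : ∀ x : Fin n → ι, Real.exp (-(n * W)) * ∏ i, q (x i) ≤
      (if n * (-r) ≤ ∑ i, L (x i) then ∏ i, p (x i) else 0)
      + Real.exp (-(n * W)) * (if n * (μ + δ / 2) ≤ ∑ i, L (x i) then ∏ i, q (x i) else 0)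
      + Real.exp (-(n * W)) *
        (if n * (-μ + δ / 2) ≤ ∑ i, -L (x i) then ∏ i, q (x i) else 0) := by
    intro x
    have hE := Real.exp_pos (-(n * W))
    have hEq := mul_nonneg hE.le (hqn x)
    have hp0 : 0 ≤ (if n * (-r) ≤ ∑ i, L (x i) then ∏ i, p (x i) else 0) := by
      split_ifs; exacts [hpn x, le_rfl]
    by_cases h1 : n * (μ + δ / 2) ≤ ∑ i, L (x i)
    · rw [if_pos h1]
      have : 0 ≤ Real.exp (-(n * W)) *
        (if n * (-μ + δ / 2) ≤ ∑ i, -L (x i) then ∏ i, q (x i) else 0) := by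
        split_ifs; exacts [hEq, by simp]
      linarith
    by_cases h2 : n * (-μ + δ / 2) ≤ ∑ i, -L (x i)
    · rw [if_pos h2, if_neg h1]
      linarith
    have hn0 : (0 : ℝ) ≤ n := n.cast_nonneg
    have h3 : n * (-r) ≤ ∑ i, L (x i) := by
      rw [Finset.sum_neg_distrib] at h2
      nlinarith [mul_nonneg hn0 (neg_nonneg.2 hle)]
    rw [if_neg h1, if_neg h2, if_pos h3, mul_zero, add_zero, add_zero]
    have hprod : ∏ i, q (x i) = (∏ i, p (x i)) * Real.exp (s * ∑ i, L (x i) - n * Real.log Z) := by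
      rw [hq, Finset.prod_div_distrib, Finset.prod_mul_distrib, Real.exp_sub, Finset.mul_sum,
        Real.exp_sum, Real.exp_nat_mul, Real.exp_log hZpos]
      simp [mul_div_assoc]
    rw [hprod, mul_left_comm, ← Real.exp_add]
    refine mul_le_of_le_one_right (hpn x) (Real.exp_le_one_iff.2 ?_)
    -- The upper edge of the window costs s(μ + δ/2) = sδ - sr per letter, exactly the slack sδ in
    -- the hypothesis.
    have h4 : s * ∑ i, L (x i) ≤ s * (n * (μ + δ / 2)) :=
      mul_le_mul_of_nonneg_left (not_le.1 h1).le hs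
    have h5 : n * (-Real.log Z - s * r) ≤ n * (W - s * δ) := mul_le_mul_of_nonneg_left hexp hn0
    have h6 : s * (n * (μ + δ / 2)) = n * (s * δ - s * r) := by
      linear_combination (-(n : ℝ)) * hcrit
    nlinarith
  have hsum := Finset.sum_le_sum fun x (_ : x ∈ Finset.univ) => hpt x
  rw [← Finset.mul_sum, htot, Finset.sum_add_distrib, Finset.sum_add_distrib, ← Finset.mul_sum,
    ← Finset.mul_sum, ← Finset.sum_filter, ← Finset.sum_filter, ← Finset.sum_filter] at hsum
  change _ ≤ upperTail p L n (-r) + _ * upperTail q L n (μ + δ / 2) +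
    _ * upperTail q (fun x => -L x) n (-μ + δ / 2) at hsum
  nlinarith [Real.exp_pos (-(n * W))]

end ExponentialMoments

/-! ### Leftover hashing and the one-shot bound -/

section Hashing

variable {A E : Type*} [Fintype A] [Fintype E] {P : A × E → ℝ}

lemma le_margE (hP : P ∈ stdSimplex ℝ (A × E)) (x : A × E) : P x ≤ margE P x.2 :=
  Finset.single_le_sum (f := fun a => P (a, x.2)) (fun a _ => hP.1 (a, x.2)) (Finset.mem_univ x.1)

lemma condProb_nonneg (hP : P ∈ stdSimplex ℝ (A × E)) (x : A × E) : 0 ≤ condProb P x :=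
  div_nonneg (hP.1 x) ((hP.1 x).trans (le_margE hP x))

lemma condProb_le_one (hP : P ∈ stdSimplex ℝ (A × E)) (x : A × E) : condProb P x ≤ 1 :=
  div_le_one_of_le₀ (le_margE hP x) ((hP.1 x).trans (le_margE hP x))

lemma condProb_pos (hP : P ∈ stdSimplex ℝ (A × E)) {x : A × E} (hx : 0 < P x) :
    0 < condProb P x :=
  div_pos hx (hx.trans_le (le_margE hP x))

lemma sum_hashDist_mul {M : ℕ} (P : A × E → ℝ) (f : A → Fin M) (g : Fin M × E → ℝ) :
    ∑ y, hashDist P f y * g y = ∑ x : A × E, P x * g (f x.1, x.2) := by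
  simp_rw [hashDist, Fintype.sum_prod_type, Finset.sum_mul]
  rw [Finset.sum_comm, Finset.sum_comm (s := (Finset.univ : Finset A))]
  refine Finset.sum_congr rfl fun e _ => ?_
  simp_rw [Finset.sum_filter]
  rw [Finset.sum_comm]
  exact Finset.sum_congr rfl fun a _ => by simp

lemma hashDist_mem_stdSimplex (hP : P ∈ stdSimplex ℝ (A × E)) {M : ℕ} (f : A → Fin M) :
    hashDist P f ∈ stdSimplex ℝ (Fin M × E) :=
  ⟨fun y => Finset.sum_nonneg fun a _ => hP.1 _, by
    simpa [hP.2] using sum_hashDist_mul P f fun _ => 1⟩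

lemma margA_mem_stdSimplex (hP : P ∈ stdSimplex ℝ (A × E)) : margA P ∈ stdSimplex ℝ A :=
  ⟨fun a => Finset.sum_nonneg fun e _ => hP.1 _, by
    simpa [margA, Fintype.sum_prod_type] using hP.2⟩

lemma margE_hashDist {A E : Type*} [Fintype A] {M : ℕ} (P : A × E → ℝ) (f : A → Fin M) (e : E) :
    margE (hashDist P f) e = margE P e :=
  Finset.sum_fiberwise Finset.univ f fun a => P (a, e)

lemma entropy_le_log_card {M : ℕ} {p : Fin M → ℝ} (hp : p ∈ stdSimplex ℝ (Fin M)) :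
    entropy p ≤ Real.log M := by
  obtain ⟨x, -⟩ := exists_pos_of_mem_stdSimplex hp
  have hM : (0 : ℝ) < M := by exact_mod_cast x.pos
  have h := Real.concaveOn_negMulLog.le_map_sum (t := Finset.univ) (w := fun _ : Fin M => (M : ℝ)⁻¹)
    (p := p) (fun _ _ => by positivity) (by simp [hM.ne']) (fun i _ => hp.1 i)
  simp only [smul_eq_mul, ← Finset.mul_sum, hp.2, mul_one, Real.negMulLog, Real.log_inv,
    neg_mul_neg] at h
  simpa [entropy, Real.negMulLog] using le_of_mul_le_mul_left h (inv_pos.2 hM)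

/-- The entropy of the output is at most log M. The larger quantity is an average of logarithms, so
Jensen applies, and it also controls how far the output is from uniform. -/
lemma mutualInfo_hashDist_le (hP : P ∈ stdSimplex ℝ (A × E)) {M : ℕ} (f : A → Fin M) :
    mutualInfo (hashDist P f) ≤ Real.log M - condEntropy (hashDist P f) :=
  sub_le_sub_right (entropy_le_log_card (margA_mem_stdSimplex (hashDist_mem_stdSimplex hP f))) _

lemma condEntropy_le_entropy_margA (hP : P ∈ stdSimplex ℝ (A × E)) :
    condEntropy P ≤ entropy (margA P) := by
  -- If P^E(e) = 0 the quotient has the default value 0, and P x vanishes too.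
  have hm : ∀ x : A × E, margE P x.2 * condProb P x = P x := by
    intro x
    rcases ((hP.1 x).trans (le_margE hP x)).eq_or_lt with h | h
    · rw [← h, zero_mul]
      exact le_antisymm (hP.1 x) (h ▸ le_margE hP x)
    · exact mul_div_cancel₀ _ h.ne'
  have hsum : ∑ e, margE P e = 1 := by
    rw [← hP.2, Fintype.sum_prod_type_right]; rfl
  rw [condEntropy, entropy, Fintype.sum_prod_type, ← Finset.sum_neg_distrib]
  refine Finset.sum_le_sum fun a _ => ?_
  have h := Real.concaveOn_negMulLog.le_map_sum (t := Finset.univ) (w := margE P)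
    (p := fun e => condProb P (a, e)) (fun e _ => Finset.sum_nonneg fun a _ => hP.1 _) hsum
    (fun e _ => condProb_nonneg hP (a, e))
  simp only [smul_eq_mul, hm (a, _)] at h
  refine le_trans (le_of_eq ?_) h
  rw [← Finset.sum_neg_distrib]
  refine Finset.sum_congr rfl fun e _ => ?_
  rw [Real.negMulLog, ← mul_assoc, mul_neg, hm (a, e), neg_mul]

lemma le_hashDist (hP : P ∈ stdSimplex ℝ (A × E)) {M : ℕ} (f : A → Fin M) (x : A × E) :
    P x ≤ hashDist P f (f x.1, x.2) :=
  Finset.single_le_sum (f := fun a => P (a, x.2)) (fun a _ => hP.1 (a, x.2))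
    (Finset.mem_filter.2 ⟨Finset.mem_univ x.1, rfl⟩)

/-- In the fibre of f(a), the point a itself contributes P(a,e), and every other point joins with
probability at most 1/M. -/
lemma sum_mul_condProb_hashDist_le [DecidableEq A] (hP : P ∈ stdSimplex ℝ (A × E)) {M : ℕ}
    {q : (A → Fin M) → ℝ} (hq : IsUniversalTwo q) (x : A × E) :
    ∑ f, q f * condProb (hashDist P f) (f x.1, x.2) ≤ condProb P x + 1 / M := by
  have hm : 0 ≤ margE P x.2 := (hP.1 x).trans (le_margE hP x)
  have hcoll : ∑ f, q f * hashDist P f (f x.1, x.2) ≤ P x + margE P x.2 * (1 / M) := by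
    have h1 : ∑ f, q f * hashDist P f (f x.1, x.2)
        = ∑ a, P (a, x.2) * ∑ f with f a = f x.1, q f := by
      simp_rw [hashDist, Finset.sum_filter, Finset.mul_sum]
      rw [Finset.sum_comm]
      refine Finset.sum_congr rfl fun a _ => Finset.sum_congr rfl fun f _ => ?_
      split_ifs <;> ring
    rw [h1, margE, Finset.sum_mul]
    have h2 : P x = ∑ a, if a = x.1 then P (a, x.2) else 0 := by simp
    rw [h2, ← Finset.sum_add_distrib]
    refine Finset.sum_le_sum fun a _ => ?_
    have hPa := hP.1 (a, x.2)
    have hM : (0 : ℝ) ≤ 1 / M := by positivity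
    split_ifs with h
    · have : ∑ f with f a = f x.1, q f ≤ 1 := by
        rw [← hq.1.2]
        exact Finset.sum_le_sum_of_subset_of_nonneg (Finset.filter_subset _ _) fun f _ _ => hq.1.1 f
      nlinarith [mul_nonneg hPa hM]
    · rw [zero_add]
      exact mul_le_mul_of_nonneg_left (hq.2 a x.1 h) hPa
  simp_rw [condProb, margE_hashDist, ← mul_div_assoc, ← Finset.sum_div]
  rcases hm.eq_or_lt with h | h
  · rw [← h, div_zero, div_zero]; positivity
  · rw [div_add' _ _ _ h.ne']
    gcongr
    linarith

/-- Leftover hashing: the expected deviation of a hashed value from a uniform one that is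
independent of `E`. -/
lemma sum_mul_log_sub_condEntropy_le [DecidableEq A] (hP : P ∈ stdSimplex ℝ (A × E)) {M : ℕ}
    {q : (A → Fin M) → ℝ} (hq : IsUniversalTwo q) :
    ∑ f, q f * (Real.log M - condEntropy (hashDist P f))
      ≤ ∑ x, P x * Real.log (1 + M * condProb P x) := by
  obtain ⟨f₀, -⟩ := exists_pos_of_mem_stdSimplex hq.1
  obtain ⟨x₀, -⟩ := exists_pos_of_mem_stdSimplex hP
  have hM : (0 : ℝ) < M := by exact_mod_cast (f₀ x₀.1).pos
  have h1 : ∀ f : A → Fin M, Real.log M - condEntropy (hashDist P f)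
      = ∑ x, P x * (Real.log M + Real.log (condProb (hashDist P f) (f x.1, x.2))) := by
    intro f
    rw [condEntropy, sum_hashDist_mul P f fun y => Real.log (condProb (hashDist P f) y)]
    simp_rw [mul_add, Finset.sum_add_distrib, ← Finset.sum_mul, hP.2]
    ring
  simp_rw [h1, Finset.mul_sum]
  rw [Finset.sum_comm]
  refine Finset.sum_le_sum fun x _ => ?_
  rcases (hP.1 x).eq_or_lt with hx | hx
  · simp [← hx]
  have hpos : ∀ f : A → Fin M, 0 < condProb (hashDist P f) (f x.1, x.2) := fun f =>
    condProb_pos (hashDist_mem_stdSimplex hP f) (hx.trans_le (le_hashDist hP f x))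
  simp_rw [mul_left_comm _ (P x), ← Finset.mul_sum]
  refine mul_le_mul_of_nonneg_left ?_ hx.le
  -- Jensen moves the average over f inside the logarithm, where the collision bound applies.
  have hJ := strictConcaveOn_log_Ioi.concaveOn.le_map_sum (t := Finset.univ) (w := q)
    (p := fun f => M * condProb (hashDist P f) (f x.1, x.2)) (fun f _ => hq.1.1 f) hq.1.2
    (fun f _ => mul_pos hM (hpos f))
  simp only [smul_eq_mul, Real.log_mul hM.ne' (hpos _).ne'] at hJ
  refine hJ.trans (Real.log_le_log ?_ ?_)
  · obtain ⟨f, hf⟩ := exists_pos_of_mem_stdSimplex hq.1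
    exact Finset.sum_pos' (fun g _ => mul_nonneg (hq.1.1 g) (mul_pos hM (hpos g)).le)
      ⟨f, Finset.mem_univ f, mul_pos hf (mul_pos hM (hpos f))⟩
  · simp_rw [mul_left_comm _ (M : ℝ), ← Finset.mul_sum]
    refine (mul_le_mul_of_nonneg_left (sum_mul_condProb_hashDist_le hP hq x) hM.le).trans ?_
    rw [mul_add, mul_one_div_cancel hM.ne', add_comm]

/-- Every candidate is a value of -log P^{A|E}; finiteness makes the `sSup` in the definition an
attained maximum. -/
lemma finite_smoothMinEntropy_set (P : A × E → ℝ) (ε : ℝ) :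
    {h : ℝ | ∃ Ω : Finset (A × E), 1 - ε ≤ ∑ x ∈ Ω, P x ∧
      IsLeast ((fun x => -Real.log (condProb P x)) '' {x | x ∈ Ω ∧ 0 < P x}) h}.Finite := by
  refine (Set.finite_range fun x => -Real.log (condProb P x)).subset ?_
  rintro h ⟨Ω, -, ⟨x, -, hx⟩, -⟩
  exact ⟨x, hx⟩

lemma exists_isLeast_neg_log_condProb {A E : Type*} [Fintype A] {P : A × E → ℝ} {ε : ℝ} (h1 : ε < 1) {Ω : Finset (A × E)}
    (hΩ : 1 - ε ≤ ∑ x ∈ Ω, P x) :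
    ∃ h, IsLeast ((fun x => -Real.log (condProb P x)) '' {x | x ∈ Ω ∧ 0 < P x}) h := by
  have hfin : ((fun x => -Real.log (condProb P x)) '' {x | x ∈ Ω ∧ 0 < P x}).Finite :=
    (Ω.finite_toSet.subset fun x hx => hx.1).image _
  have hne : {x | x ∈ Ω ∧ 0 < P x}.Nonempty := by
    by_contra! h
    have : ∑ x ∈ Ω, P x ≤ 0 := Finset.sum_nonpos fun x hx => by
      by_contra! hx0
      exact Set.notMem_empty x (h ▸ ⟨hx, hx0⟩)
    linarith
  obtain ⟨h, hmem, hle⟩ := hfin.exists_minimalFor id _ (hne.image _)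
  exact ⟨h, hmem, fun y hy => (le_total h y).elim id fun hy' => hle hy hy'⟩

lemma exists_finset_condProb_le (hP : P ∈ stdSimplex ℝ (A × E)) {ε : ℝ} (h0 : 0 ≤ ε)
    (h1 : ε < 1) :
    ∃ Ω : Finset (A × E), 1 - ε ≤ ∑ x ∈ Ω, P x ∧
      ∀ x ∈ Ω, 0 < P x → condProb P x ≤ Real.exp (-smoothMinEntropy P ε) := by
  have huniv : 1 - ε ≤ ∑ x, P x := by rw [hP.2]; linarith
  obtain ⟨h, hh⟩ := exists_isLeast_neg_log_condProb h1 huniv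
  have hne : {h : ℝ | ∃ Ω : Finset (A × E), 1 - ε ≤ ∑ x ∈ Ω, P x ∧
      IsLeast ((fun x => -Real.log (condProb P x)) '' {x | x ∈ Ω ∧ 0 < P x}) h}.Nonempty :=
    ⟨h, Finset.univ, huniv, hh⟩
  obtain ⟨Ω, hΩ, hl⟩ := hne.csSup_mem (finite_smoothMinEntropy_set P ε)
  refine ⟨Ω, hΩ, fun x hx hpos => ?_⟩
  have := hl.2 ⟨x, ⟨hx, hpos⟩, rfl⟩
  rw [← Real.log_le_iff_le_exp (condProb_pos hP hpos)]
  change smoothMinEntropy P ε ≤ _ at this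
  linarith

/-- Discard exactly the points with P^{A|E} ≥ e^{-h}; what remains is an admissible Ω. -/
lemma le_smoothMinEntropy (hP : P ∈ stdSimplex ℝ (A × E)) {ε h : ℝ} (h1 : ε < 1)
    (hmass : ∑ x with Real.exp (-h) ≤ condProb P x, P x ≤ ε) : h ≤ smoothMinEntropy P ε := by
  set Ω : Finset (A × E) := {x | ¬ Real.exp (-h) ≤ condProb P x}
  have hΩ : 1 - ε ≤ ∑ x ∈ Ω, P x := by
    have := Finset.sum_filter_add_sum_filter_not Finset.univ
      (fun x => Real.exp (-h) ≤ condProb P x) P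
    rw [hP.2] at this
    linarith
  obtain ⟨k, hk⟩ := exists_isLeast_neg_log_condProb h1 hΩ
  refine le_trans ?_ (le_csSup (finite_smoothMinEntropy_set P ε).bddAbove ⟨Ω, hΩ, hk⟩)
  obtain ⟨x, ⟨hx, hpos⟩, rfl⟩ := hk.1
  have := (Real.log_lt_iff_lt_exp (condProb_pos hP hpos)).2 (not_le.1 (Finset.mem_filter.1 hx).2)
  change h ≤ -Real.log (condProb P x)
  linarith

/-- The penalty term of `smoothLeakageBound` dominates the smoothing error. -/
lemma mul_log_le_two_mul_eta {ε m : ℝ} (h0 : 0 < ε) (h1 : ε < 1 / 4) (hm : 0 ≤ m) :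
    ε * (Real.log 2 + m) ≤ 2 * eta (2 * ε) m := by
  have hl2 := Real.log_pos one_lt_two
  -- As ε < 1/4, -log(2ε) ≥ log 2, hence 2η(2ε, m) ≥ 4ε(log 2 + m).
  have hl : Real.log (2 * ε) ≤ -Real.log 2 := by
    rw [← Real.log_inv]
    exact Real.log_le_log (by linarith) (by linarith)
  unfold eta
  nlinarith [mul_nonneg h0.le hm, mul_nonneg h0.le hl2.le,
    mul_le_mul_of_nonneg_left hl h0.le]

lemma expectedLeakage_le_smoothLeakageBound [DecidableEq A] (hP : P ∈ stdSimplex ℝ (A × E))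
    {M : ℕ} {q : (A → Fin M) → ℝ} (hq : IsUniversalTwo q) :
    expectedLeakage P q ≤ smoothLeakageBound P M := by
  obtain ⟨f₀, -⟩ := exists_pos_of_mem_stdSimplex hq.1
  obtain ⟨x₀, -⟩ := exists_pos_of_mem_stdSimplex hP
  have hM : (1 : ℝ) ≤ M := by exact_mod_cast (f₀ x₀.1).pos
  have hA : (1 : ℝ) ≤ Fintype.card A := by
    exact_mod_cast Fintype.card_pos_iff.2 ⟨x₀.1⟩
  refine le_csInf ((Set.nonempty_Ioo.2 (by norm_num)).image _) ?_
  rintro _ ⟨ε, ⟨h0, h1⟩, rfl⟩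
  have hstep : expectedLeakage P q ≤ ∑ x, P x * Real.log (1 + M * condProb P x) :=
    (Finset.sum_le_sum fun f _ => mul_le_mul_of_nonneg_left (mutualInfo_hashDist_le hP f)
      (hq.1.1 f)).trans (sum_mul_log_sub_condEntropy_le hP hq)
  refine hstep.trans ?_
  obtain ⟨Ω, hΩ, hc⟩ := exists_finset_condProb_le hP h0.le (h1.trans (by norm_num))
  set K := M * Real.exp (-smoothMinEntropy P ε) with hK
  have hK0 : 0 ≤ K := by positivity
  have hl0 : 0 ≤ Real.log (1 + M) := Real.log_nonneg (by linarith)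
  classical
  rw [← Finset.sum_add_sum_compl Ω]
  have hcompl : ∑ x ∈ Ωᶜ, P x ≤ ε := by
    have := Finset.sum_add_sum_compl Ω P
    rw [hP.2] at this
    linarith
  have hle1 : ∑ x ∈ Ω, P x ≤ 1 := by
    rw [← hP.2]
    exact Finset.sum_le_univ_sum_of_nonneg hP.1
  refine add_le_add ?_ ?_
  · calc _ ≤ ∑ x ∈ Ω, P x * K := Finset.sum_le_sum fun x hx => by
          rcases (hP.1 x).eq_or_lt with h | h
          · simp [← h]
          refine mul_le_mul_of_nonneg_left ?_ h.le
          have hcp := condProb_pos hP h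
          have := Real.log_le_sub_one_of_pos (x := 1 + M * condProb P x) (by positivity)
          have h2 : M * condProb P x ≤ K :=
            mul_le_mul_of_nonneg_left (hc x hx h) (by linarith)
          linarith
      _ ≤ K := by
          rw [← Finset.sum_mul]
          exact mul_le_of_le_one_left hK0 hle1
  · calc _ ≤ ∑ x ∈ Ωᶜ, P x * Real.log (1 + M) := Finset.sum_le_sum fun x _ => by
          have h2 := condProb_nonneg hP x
          refine mul_le_mul_of_nonneg_left (Real.log_le_log (by positivity) ?_) (hP.1 x)
          nlinarith [condProb_le_one hP x]
      _ ≤ ε * Real.log (1 + M) := by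
          rw [← Finset.sum_mul]
          exact mul_le_mul_of_nonneg_right hcompl hl0
      _ ≤ ε * (Real.log 2 + Real.log (Fintype.card A * M)) := by
          refine mul_le_mul_of_nonneg_left ?_ h0.le
          rw [← Real.log_mul (by norm_num) (by positivity)]
          exact Real.log_le_log (by linarith) (by nlinarith)
      _ ≤ _ := mul_log_le_two_mul_eta h0 h1 (Real.log_nonneg (by nlinarith))

end Hashing

/-! ### I.i.d. extensions and the asymptotics of the bound -/

section Iid

variable {A E : Type*} [Fintype A] [Fintype E] {P : A × E → ℝ}

lemma sum_prod_arrow {M : Type*} [AddCommMonoid M] (n : ℕ)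
    (g : (Fin n → A) × (Fin n → E) → M) :
    ∑ x, g x = ∑ y : Fin n → A × E, g (fun i => (y i).1, fun i => (y i).2) :=
  ((Equiv.arrowProdEquivProdArrow (Fin n) (fun _ => A) fun _ => E).sum_comp g).symm

lemma iidDist_mem_stdSimplex (hP : P ∈ stdSimplex ℝ (A × E)) (n : ℕ) :
    iidDist P n ∈ stdSimplex ℝ ((Fin n → A) × (Fin n → E)) := by
  refine ⟨fun x => Finset.prod_nonneg fun i _ => hP.1 _, ?_⟩
  rw [sum_prod_arrow]
  simp only [iidDist, Prod.mk.eta]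
  rw [← Fintype.sum_pow, hP.2, one_pow]

lemma condProb_iidDist {A E : Type*} [Fintype A] (P : A × E → ℝ) (n : ℕ)
    (x : (Fin n → A) × (Fin n → E)) :
    condProb (iidDist P n) x = ∏ i, condProb P (x.1 i, x.2 i) := by
  have : margE (iidDist P n) x.2 = ∏ i, margE P (x.2 i) := by
    classical
    simp only [margE, iidDist]
    rw [Finset.prod_univ_sum, Fintype.piFinset_univ]
  rw [condProb, this, iidDist, ← Finset.prod_div_distrib]
  rfl

/-- The support condition matters: the convention `Real.log 0 = 0` would turn a zero factor into 1.
-/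
lemma condProb_iidDist_eq_exp (hP : P ∈ stdSimplex ℝ (A × E)) {n : ℕ} {y : Fin n → A × E}
    (hy : ∏ i, P (y i) ≠ 0) :
    condProb (iidDist P n) (fun i => (y i).1, fun i => (y i).2)
      = Real.exp (∑ i, Real.log (condProb P (y i))) := by
  rw [condProb_iidDist, Real.exp_sum]
  refine Finset.prod_congr rfl fun i _ => (Real.exp_log (condProb_pos hP ?_)).symm
  exact (hP.1 _).lt_of_ne' (Finset.prod_ne_zero_iff.1 hy i (Finset.mem_univ i))

lemma sum_iidDist_condProb_ge (hP : P ∈ stdSimplex ℝ (A × E)) (n : ℕ) (r : ℝ) :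
    ∑ x with Real.exp (-(n * r)) ≤ condProb (iidDist P n) x, iidDist P n x
      = upperTail P (fun x => Real.log (condProb P x)) n (-r) := by
  rw [Finset.sum_filter, sum_prod_arrow, upperTail, Finset.sum_filter]
  refine Finset.sum_congr rfl fun y _ => ?_
  simp only [iidDist, Prod.mk.eta]
  by_cases hy : ∏ i, P (y i) = 0
  · simp [hy]
  · simp only [condProb_iidDist_eq_exp hP hy, Real.exp_le_exp, mul_neg]

lemma sum_iidDist_mul_condProb_rpow (hP : P ∈ stdSimplex ℝ (A × E)) (n : ℕ) (s : ℝ) :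
    ∑ x, iidDist P n x * condProb (iidDist P n) x ^ s
      = expMoment P (fun x => Real.log (condProb P x)) s ^ n := by
  rw [sum_prod_arrow, expMoment, Fintype.sum_pow]
  refine Finset.sum_congr rfl fun y _ => ?_
  rw [Finset.prod_mul_distrib]
  by_cases hy : ∏ i, P (y i) = 0
  · simp [hy, iidDist]
  · rw [condProb_iidDist_eq_exp hP hy, ← Real.exp_mul, ← Real.exp_sum, ← Finset.mul_sum,
      mul_comm s]
    rfl

lemma renyiTilde_eq (hP : P ∈ stdSimplex ℝ (A × E)) {s : ℝ} (hs : 0 ≤ s) :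
    renyiTilde P s = -Real.log (expMoment P (fun x => Real.log (condProb P x)) s) := by
  rw [renyiTilde, expMoment]
  congr 2
  refine Finset.sum_congr rfl fun x _ => ?_
  rcases (hP.1 x).eq_or_lt with h | h
  · simp [condProb, ← h, Real.zero_rpow (by linarith : 1 + s ≠ 0)]
  · have hc := condProb_pos hP h
    rw [Real.rpow_add hc, Real.rpow_one, Real.rpow_def_of_pos hc, ← mul_assoc, mul_comm s]
    congr 1
    exact mul_div_cancel₀ _ (h.trans_le (le_margE hP x)).ne'

lemma one_le_card_mul (hP : P ∈ stdSimplex ℝ (A × E)) {M : ℝ} (hM : 1 ≤ M) :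
    1 ≤ Fintype.card A * M := by
  obtain ⟨x, -⟩ := exists_pos_of_mem_stdSimplex hP
  have hA : (1 : ℝ) ≤ Fintype.card A := by
    exact_mod_cast Fintype.card_pos_iff.2 ⟨x.1⟩
  nlinarith

lemma mul_log_two_le_two_mul_eta (hP : P ∈ stdSimplex ℝ (A × E)) {M ε : ℝ} (hM : 1 ≤ M)
    (h0 : 0 < ε) (h1 : ε < 1 / 4) :
    Real.log 2 * ε ≤ 2 * eta (2 * ε) (Real.log (Fintype.card A * M)) := by
  have hl := Real.log_nonneg (one_le_card_mul hP hM)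
  have h := mul_log_le_two_mul_eta h0 h1 hl
  nlinarith [mul_nonneg h0.le hl]

lemma smoothLeakageBound_le (hP : P ∈ stdSimplex ℝ (A × E)) {M ε : ℝ} (hM : 1 ≤ M)
    (h0 : 0 < ε) (h1 : ε < 1 / 4) :
    smoothLeakageBound P M ≤ M * Real.exp (-smoothMinEntropy P ε)
      + 2 * eta (2 * ε) (Real.log (Fintype.card A * M)) := by
  refine csInf_le ⟨0, ?_⟩ ⟨ε, ⟨h0, h1⟩, rfl⟩
  rintro _ ⟨u, ⟨hu0, hu1⟩, rfl⟩
  have h2 := mul_log_two_le_two_mul_eta hP hM hu0 hu1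
  have h3 := mul_pos (Real.log_pos one_lt_two) hu0
  have h4 : 0 ≤ M * Real.exp (-smoothMinEntropy P u) := by positivity
  linarith

/-- For each ε, either H_min^ε ≤ h and the first term is at least M e^{-h}, or the optimal Ω avoids
all points of positive mass with P^{A|E} ≥ e^{-h}; then their mass is at most ε, which the η term
dominates. -/
lemma min_le_smoothLeakageBound (hP : P ∈ stdSimplex ℝ (A × E)) {M : ℝ} (hM : 1 ≤ M) (h : ℝ) :
    min (M * Real.exp (-h)) (Real.log 2 * ∑ x with Real.exp (-h) ≤ condProb P x, P x)
      ≤ smoothLeakageBound P M := by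
  have hl2 := Real.log_pos one_lt_two
  refine le_csInf ((Set.nonempty_Ioo.2 (by norm_num)).image _) ?_
  rintro _ ⟨ε, ⟨h0, h1⟩, rfl⟩
  have heta := mul_log_two_le_two_mul_eta hP hM h0 h1
  have hMp : 0 < M := by linarith
  by_cases hh : smoothMinEntropy P ε ≤ h
  · refine (min_le_left _ _).trans ?_
    have : M * Real.exp (-h) ≤ M * Real.exp (-smoothMinEntropy P ε) := by gcongr
    have := mul_pos hl2 h0
    linarith
  refine (min_le_right _ _).trans ?_
  have hpos : 0 < M * Real.exp (-smoothMinEntropy P ε) := by positivity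
  obtain ⟨Ω, hΩ, hc⟩ := exists_finset_condProb_le hP h0.le (h1.trans (by norm_num))
  have hQ : ∑ x with Real.exp (-h) ≤ condProb P x, P x ≤ ε := by
    classical
    calc _ ≤ ∑ x ∈ Ωᶜ, P x := by
          rw [← Finset.sum_filter_add_sum_filter_not _ (fun x => x ∈ Ω)]
          have hz : ∑ x ∈ ({x | Real.exp (-h) ≤ condProb P x} : Finset (A × E)) with x ∈ Ω, P x
              ≤ 0 := by
            refine Finset.sum_nonpos fun x hx => ?_
            simp only [Finset.mem_filter, Finset.mem_univ, true_and] at hx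
            by_contra! hx0
            have := hx.1.trans (hc x hx.2 hx0)
            rw [Real.exp_le_exp] at this
            linarith
          refine le_trans (add_le_add_left hz _) ?_
          rw [zero_add]
          refine Finset.sum_le_sum_of_subset_of_nonneg (fun x hx => ?_) fun x _ _ => hP.1 x
          simpa using (Finset.mem_filter.1 hx).2
      _ ≤ ε := by
          have := Finset.sum_add_sum_compl Ω P
          rw [hP.2] at this
          linarith
  have := mul_le_mul_of_nonneg_left hQ hl2.le
  linarith

/-- Take ε = e^{-nc}: by Chernoff it covers the tail at rate r. The factor 4n(c + log|A| + R) comes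
from expanding 2η(2ε, ·). -/
lemma eventually_smoothLeakageBound_le (hP : P ∈ stdSimplex ℝ (A × E)) {R r s c : ℝ} (hR : 0 ≤ R)
    (hs : 0 ≤ s) (hc : 0 < c) (hcr : c ≤ renyiTilde P s - s * r) :
    ∀ᶠ n : ℕ in atTop, smoothLeakageBound (iidDist P n) (Real.exp (n * R))
      ≤ Real.exp (n * (R - r))
        + 4 * (c + Real.log (Fintype.card A) + R) * n * Real.exp (-(n * c)) := by
  have hlim : Tendsto (fun n : ℕ => Real.exp (-(n * c))) atTop (𝓝 0) :=
    Real.tendsto_exp_neg_atTop_nhds_zero.comp (tendsto_natCast_atTop_atTop.atTop_mul_const hc)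
  filter_upwards [hlim.eventually (gt_mem_nhds (show (0 : ℝ) < 1 / 4 by norm_num))] with n hn
  set ε := Real.exp (-(n * c)) with hε
  have hε0 : 0 < ε := Real.exp_pos _
  have hPn := iidDist_mem_stdSimplex hP n
  have hn0 : (0 : ℝ) ≤ n := n.cast_nonneg
  refine (smoothLeakageBound_le hPn (Real.one_le_exp (by positivity)) hε0 hn).trans
    (add_le_add ?_ ?_)
  · have hmin : n * r ≤ smoothMinEntropy (iidDist P n) ε := by
      refine le_smoothMinEntropy hPn (hn.trans (by norm_num)) ?_
      rw [sum_iidDist_condProb_ge hP]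
      refine (upperTail_le hP _ n r hs).trans (Real.exp_le_exp.2 ?_)
      rw [← renyiTilde_eq hP hs]
      exact neg_le_neg (mul_le_mul_of_nonneg_left hcr hn0)
    rw [← Real.exp_add]
    exact Real.exp_le_exp.2 (by linarith)
  · obtain ⟨x, -⟩ := exists_pos_of_mem_stdSimplex hP
    have hA : (0 : ℝ) < Fintype.card A := by
      exact_mod_cast Fintype.card_pos_iff.2 ⟨x.1⟩
    have hcard : Real.log (Fintype.card (Fin n → A) * Real.exp (n * R))
        = n * Real.log (Fintype.card A) + n * R := by
      rw [Fintype.card_fun, Fintype.card_fin, Nat.cast_pow, Real.log_mul (by positivity)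
        (Real.exp_pos _).ne', Real.log_exp, Real.log_pow]
    have hl : Real.log (2 * ε) = Real.log 2 - n * c := by
      rw [Real.log_mul (by norm_num) hε0.ne', hε, Real.log_exp, sub_eq_add_neg]
    rw [eta, hcard, hl]
    have := mul_pos hε0 (Real.log_pos one_lt_two)
    nlinarith

lemma eventually_one_add_mul_le_exp (C : ℝ) {δ : ℝ} (hδ : 0 < δ) :
    ∀ᶠ n : ℕ in atTop, 1 + C * n ≤ Real.exp (n * δ) := by
  filter_upwards [eventually_ge_atTop ⌈2 * C / δ ^ 2⌉₊] with n hn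
  have h1 : 2 * C ≤ n * δ ^ 2 := (div_le_iff₀ (by positivity)).1 (Nat.ceil_le.1 hn)
  have hn0 : (0 : ℝ) ≤ n := n.cast_nonneg
  have h2 := Real.quadratic_le_exp_of_nonneg (mul_nonneg hn0 hδ.le)
  nlinarith [mul_nonneg hn0 hδ.le, mul_le_mul_of_nonneg_left h1 hn0]

lemma tendsto_neg_div_mul_log {b : ℕ → ℝ} {W : ℝ}
    (hlo : ∀ δ > 0, ∀ᶠ n : ℕ in atTop, Real.exp (-(n * (W + δ))) ≤ b n)
    (hup : ∀ δ > 0, ∀ᶠ n : ℕ in atTop, b n ≤ Real.exp (-(n * (W - δ)))) :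
    Tendsto (fun n : ℕ => -(1 / (n : ℝ)) * Real.log (b n)) atTop (𝓝 W) := by
  rw [Metric.tendsto_atTop']
  intro δ hδ
  obtain ⟨N, hN⟩ := eventually_atTop.1
    (((hlo _ (half_pos hδ)).and (hup _ (half_pos hδ))).and (eventually_gt_atTop 0))
  refine ⟨N, fun n hn => ?_⟩
  obtain ⟨⟨h1, h2⟩, h0⟩ := hN n hn.le
  have hn0 : (0 : ℝ) < n := by exact_mod_cast h0
  have hb := (Real.exp_pos _).trans_le h1
  rw [← Real.le_log_iff_exp_le hb] at h1
  rw [← Real.log_le_iff_le_exp hb] at h2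
  have hx : -(1 / (n : ℝ)) * Real.log (b n) = -Real.log (b n) / n := by ring
  have h3 : -Real.log (b n) / n ≤ W + δ / 2 := (div_le_iff₀ hn0).2 (by linarith)
  have h4 : W - δ / 2 ≤ -Real.log (b n) / n := (le_div_iff₀ hn0).2 (by linarith)
  rw [hx, Real.dist_eq, abs_lt]
  constructor <;> linarith

/-- Use h = n(R + W + δ): then M e^{-h} = e^{-n(W+δ)}, and the hypothesis on W is Cramér's condition
at r = R + W + δ. -/
lemma eventually_exp_le_smoothLeakageBound (hP : P ∈ stdSimplex ℝ (A × E)) {R W δ : ℝ}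
    (hR : 0 ≤ R) (hW : ∀ s, 0 ≤ s → renyiTilde P s - s * R ≤ W * (1 + s)) (hδ : 0 < δ) :
    ∀ᶠ n : ℕ in atTop, Real.exp (-(n * (W + δ)))
      ≤ smoothLeakageBound (iidDist P n) (Real.exp (n * R)) := by
  have hl2 := Real.log_pos one_lt_two
  have htail := eventually_le_upperTail hP (L := fun x => Real.log (condProb P x))
    (r := R + W + δ) hδ (W := W) fun s hs => by
      rw [← renyiTilde_eq hP hs]
      linarith [hW s hs]
  have hexp : ∀ᶠ n : ℕ in atTop, 2 / Real.log 2 ≤ Real.exp (n * δ) :=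
    (Real.tendsto_exp_atTop.comp (tendsto_natCast_atTop_atTop.atTop_mul_const hδ)).eventually_ge_atTop _
  filter_upwards [htail, hexp] with n h1 h2
  refine le_trans (le_min ?_ ?_) (min_le_smoothLeakageBound (iidDist_mem_stdSimplex hP n)
    (Real.one_le_exp (by positivity)) (n * (R + W + δ)))
  · rw [← Real.exp_add]
    exact Real.exp_le_exp.2 (by linarith)
  · rw [sum_iidDist_condProb_ge hP]
    refine le_trans ?_ (mul_le_mul_of_nonneg_left h1 hl2.le)
    have h3 : Real.exp (-(n * W)) = Real.exp (n * δ) * Real.exp (-(n * (W + δ))) := by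
      rw [← Real.exp_add]; congr 1; ring
    rw [div_le_iff₀ hl2] at h2
    rw [h3]
    nlinarith [Real.exp_pos (-(n * (W + δ)))]

lemma eventually_smoothLeakageBound_le_exp (hP : P ∈ stdSimplex ℝ (A × E)) {R r s c w δ : ℝ}
    (hR : 0 ≤ R) (hs : 0 ≤ s) (hc : 0 < c) (hcr : c ≤ renyiTilde P s - s * r) (hcw : w ≤ c)
    (hrw : w ≤ r - R) (hδ : 0 < δ) :
    ∀ᶠ n : ℕ in atTop, smoothLeakageBound (iidDist P n) (Real.exp (n * R))
      ≤ Real.exp (-(n * (w - δ))) := by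
  obtain ⟨x, -⟩ := exists_pos_of_mem_stdSimplex hP
  have hA : (1 : ℝ) ≤ Fintype.card A := by
    exact_mod_cast Fintype.card_pos_iff.2 ⟨x.1⟩
  have hlA := Real.log_nonneg hA
  set C := 4 * (c + Real.log (Fintype.card A) + R) with hC
  filter_upwards [eventually_smoothLeakageBound_le hP hR hs hc hcr,
    eventually_one_add_mul_le_exp C hδ] with n h1 h2
  have hn0 : (0 : ℝ) ≤ n := n.cast_nonneg
  have hCn : 0 ≤ C * n := by positivity
  calc _ ≤ _ := h1
    _ ≤ Real.exp (-(n * w)) + C * n * Real.exp (-(n * w)) := by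
        gcongr
        · linarith [mul_le_mul_of_nonneg_left hrw hn0]
    _ = (1 + C * n) * Real.exp (-(n * w)) := by ring
    _ ≤ Real.exp (n * δ) * Real.exp (-(n * w)) := by gcongr
    _ = _ := by rw [← Real.exp_add]; congr 1; ring

end Iid

/-! ### Jensen inequalities for exponential moments -/

section Exponents

variable {ι : Type*} [Fintype ι]

/-- Jensen for the concave power x^{1/(1+s)} applied to e^{sL}. -/
lemma neg_log_expMoment_div_le {p : ι → ℝ} (hp : p ∈ stdSimplex ℝ ι) (L : ι → ℝ) {s : ℝ}
    (hs : 0 ≤ s) :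
    -Real.log (expMoment p L s) / (1 + s) ≤ -Real.log (expMoment p L (s / (1 + s))) := by
  have h1 : 0 < 1 + s := by linarith
  have h := (Real.concaveOn_rpow (p := 1 / (1 + s)) (by positivity)
    ((div_le_one h1).2 (by linarith))).le_map_sum (t := Finset.univ) (w := p)
    (p := fun x => Real.exp (s * L x)) (fun x _ => hp.1 x) hp.2 (fun x _ => (Real.exp_pos _).le)
  simp only [smul_eq_mul, ← Real.exp_mul] at h
  have h2 : ∑ x, p x * Real.exp (s * L x * (1 / (1 + s))) = expMoment p L (s / (1 + s)) :=
    Finset.sum_congr rfl fun x _ => by congr 2; ring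
  rw [h2] at h
  have h3 := Real.log_le_log (expMoment_pos hp L _) h
  change _ ≤ Real.log (expMoment p L s ^ _) at h3
  rw [Real.log_rpow (expMoment_pos hp L s)] at h3
  rw [one_div_mul_eq_div] at h3
  rw [neg_div]
  linarith

lemma neg_log_expMoment_div_lt {p : ι → ℝ} (hp : p ∈ stdSimplex ℝ ι) {L : ι → ℝ} {s : ℝ}
    (hs : 0 < s) {x y : ι} (hx : 0 < p x) (hy : 0 < p y) (hxy : L x ≠ L y) :
    -Real.log (expMoment p L s) / (1 + s) < -Real.log (expMoment p L (s / (1 + s))) := by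
  have h1 : 0 < 1 + s := by linarith
  have h := ((Real.strictConcaveOn_rpow (p := 1 / (1 + s)) (by positivity)
    ((div_lt_one h1).2 (by linarith))).lt_map_sum_iff_of_nonneg (t := Finset.univ) (w := p)
    (p := fun x => Real.exp (s * L x)) (fun x _ => hp.1 x) hp.2
    (fun x _ => (Real.exp_pos _).le)).2 ⟨x, Finset.mem_univ x, y, Finset.mem_univ y, hx.ne', hy.ne',
      fun h => hxy (mul_left_cancel₀ hs.ne' (Real.exp_injective h))⟩
  simp only [smul_eq_mul, ← Real.exp_mul] at h
  have h2 : ∑ x, p x * Real.exp (s * L x * (1 / (1 + s))) = expMoment p L (s / (1 + s)) :=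
    Finset.sum_congr rfl fun x _ => by congr 2; ring
  rw [h2] at h
  have h3 := Real.log_lt_log (expMoment_pos hp L _) h
  change _ < Real.log (expMoment p L s ^ _) at h3
  rw [Real.log_rpow (expMoment_pos hp L s)] at h3
  rw [one_div_mul_eq_div] at h3
  rw [neg_div]
  linarith

lemma continuous_neg_log_expMoment {p : ι → ℝ} (hp : p ∈ stdSimplex ℝ ι) (L : ι → ℝ) :
    Continuous fun s => -Real.log (expMoment p L s) :=
  ((continuous_expMoment p L).log fun s => (expMoment_pos hp L s).ne').neg

/-- For nonconstant `L` the function `-log (expMoment p L)` grows at a rate that is strictly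
smaller than its value at `1`. -/
lemma exists_neg_log_expMoment_le_linear {p : ι → ℝ} (hp : p ∈ stdSimplex ℝ ι) {L : ι → ℝ}
    {x y : ι} (hx : 0 < p x) (hy : 0 < p y) (hxy : L x ≠ L y) :
    ∃ k C, k < -Real.log (expMoment p L 1) ∧
      ∀ s, -Real.log (expMoment p L s) ≤ C + s * k := by
  obtain ⟨z, hz, hmax⟩ := Finset.exists_max_image ({x | 0 < p x} : Finset ι) L
    ⟨x, by simpa using hx⟩
  simp only [Finset.mem_filter, Finset.mem_univ, true_and] at hz hmax
  -- Here z maximises L on the support. Its single atom gives the linear bound; at s = 1 an atom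
  -- with smaller L makes the slope comparison strict.
  refine ⟨-L z, -Real.log (p z), ?_, fun s => ?_⟩
  · obtain ⟨w, hw, hlt⟩ : ∃ w, 0 < p w ∧ L w < L z := by
      rcases (hmax x hx).lt_or_eq with h | h
      · exact ⟨x, hx, h⟩
      · exact ⟨y, hy, (hmax y hy).lt_of_ne fun h' => hxy (h.trans h'.symm)⟩
    rw [neg_lt_neg_iff, Real.log_lt_iff_lt_exp (expMoment_pos hp L 1)]
    calc expMoment p L 1 < ∑ v, p v * Real.exp (L z) := by
          refine Finset.sum_lt_sum (fun v _ => ?_) ⟨w, Finset.mem_univ w, ?_⟩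
          · rcases (hp.1 v).eq_or_lt with h | h
            · simp [← h]
            · rw [one_mul]
              exact mul_le_mul_of_nonneg_left (Real.exp_le_exp.2 (hmax v h)) h.le
          · rw [one_mul]
            exact mul_lt_mul_of_pos_left (Real.exp_lt_exp.2 hlt) hw
      _ = Real.exp (L z) := by rw [← Finset.sum_mul, hp.2, one_mul]
  · have h1 : p z * Real.exp (s * L z) ≤ expMoment p L s :=
      Finset.single_le_sum (f := fun v => p v * Real.exp (s * L v))
        (fun v _ => mul_nonneg (hp.1 v) (Real.exp_pos _).le) (Finset.mem_univ z)
    have h2 := Real.log_le_log (mul_pos hz (Real.exp_pos _)) h1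
    rw [Real.log_mul hz.ne' (Real.exp_pos _).ne', Real.log_exp] at h2
    linarith

end Exponents

/-! ### Uniformly random functions and derandomisation -/

section RandomFunctions

variable {A E : Type*} [Fintype A] [Fintype E] {P : A × E → ℝ}

lemma isUniversalTwo_uniform (A : Type*) [Fintype A] [DecidableEq A] {M : ℕ} (hM : 0 < M) :
    IsUniversalTwo fun _ : A → Fin M => (Fintype.card (A → Fin M) : ℝ)⁻¹ := by
  have : NeZero M := ⟨hM.ne'⟩
  have hMr : (0 : ℝ) < M := by exact_mod_cast hM
  have hcard : (0 : ℝ) < Fintype.card (A → Fin M) := by exact_mod_cast Fintype.card_pos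
  refine ⟨⟨fun _ => by positivity, by simp⟩, fun a₁ a₂ h => le_of_eq ?_⟩
  -- Split off the coordinate a₁: a collision forces its value and leaves the other coordinates
  -- free.
  have hfib : ∑ f : A → Fin M with f a₁ = f a₂, (1 : ℝ)
      = Fintype.card ({a // a ≠ a₁} → Fin M) := by
    rw [Finset.sum_filter, ← (Equiv.funSplitAt a₁ (Fin M)).symm.sum_comp,
      Fintype.sum_prod_type_right]
    simp [Equiv.funSplitAt, Equiv.piSplitAt, h.symm]
  have hall : (Fintype.card (A → Fin M) : ℝ) = M * Fintype.card ({a // a ≠ a₁} → Fin M) := by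
    rw [Fintype.card_congr (Equiv.funSplitAt a₁ (Fin M)), Fintype.card_prod, Fintype.card_fin,
      Nat.cast_mul]
  rw [← mul_one (Fintype.card (A → Fin M) : ℝ)⁻¹, ← Finset.mul_sum, hfib, inv_mul_eq_div,
    div_eq_div_iff hcard.ne' hMr.ne', one_mul, hall, mul_comm]

/-- Follows from (1 + x)^s ≤ 1 + x^s and log(1 + y) ≤ y. Subadditivity of the power is what
restricts s to at most 1. -/
lemma log_one_add_le_rpow_div {x s : ℝ} (hx : 0 ≤ x) (hs : 0 < s) (hs1 : s ≤ 1) :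
    Real.log (1 + x) ≤ x ^ s / s := by
  rw [le_div_iff₀ hs, mul_comm, ← Real.log_rpow (by linarith)]
  have h1 : (1 + x) ^ s ≤ 1 + x ^ s := by
    simpa using Real.rpow_add_le_add_rpow zero_le_one hx hs.le hs1
  have h2 := Real.log_le_log (Real.rpow_pos_of_pos (by linarith) s) h1
  have h3 := Real.log_le_sub_one_of_pos (x := 1 + x ^ s) (by positivity)
  linarith

/-- Some function does no worse than the average over all functions. -/
lemma exists_log_sub_condEntropy_le (hP : P ∈ stdSimplex ℝ (A × E)) {M : ℕ} (hM : 0 < M) {s : ℝ}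
    (hs : 0 < s) (hs1 : s ≤ 1) :
    ∃ f : A → Fin M, Real.log M - condEntropy (hashDist P f)
      ≤ (M : ℝ) ^ s / s * ∑ x, P x * condProb P x ^ s := by
  classical
  have hq := isUniversalTwo_uniform A hM
  have h1 := sum_mul_log_sub_condEntropy_le hP hq
  set q : (A → Fin M) → ℝ := fun _ => (Fintype.card (A → Fin M) : ℝ)⁻¹
  have h2 : ∑ x, P x * Real.log (1 + M * condProb P x)
      ≤ (M : ℝ) ^ s / s * ∑ x, P x * condProb P x ^ s := by
    rw [Finset.mul_sum]
    refine Finset.sum_le_sum fun x _ => ?_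
    have hc := condProb_nonneg hP x
    rw [mul_left_comm]
    refine mul_le_mul_of_nonneg_left ((log_one_add_le_rpow_div (by positivity) hs hs1).trans_eq ?_)
      (hP.1 x)
    rw [Real.mul_rpow (by positivity) hc]
    ring
  by_contra! h
  have h3 := h1.trans h2
  set B := (M : ℝ) ^ s / s * ∑ x, P x * condProb P x ^ s
  obtain ⟨f, hf⟩ := exists_pos_of_mem_stdSimplex hq.1
  have h4 : ∑ f, q f * B < ∑ f, q f * (Real.log M - condEntropy (hashDist P f)) :=
    Finset.sum_lt_sum (fun f _ => mul_le_mul_of_nonneg_left (h f).le (hq.1.1 f))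
      ⟨f, Finset.mem_univ f, mul_lt_mul_of_pos_left (h f) hf⟩
  rw [← Finset.sum_mul, hq.1.2, one_mul] at h4
  linarith

end RandomFunctions

/-! ### Random hashing as a lower bound on the leakage exponent -/

section LeakageExponent

variable {A E : Type*} [Fintype A] [Fintype E] {P : A × E → ℝ}

lemma renyiTilde_zero (hP : P ∈ stdSimplex ℝ (A × E)) : renyiTilde P 0 = 0 := by
  rw [renyiTilde_eq hP le_rfl, expMoment_zero hP, Real.log_one, neg_zero]

lemma mul_condRenyi_sub (hP : P ∈ stdSimplex ℝ (A × E)) (R s : ℝ) :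
    s * (condRenyi P s - R) = renyiTilde P s - s * R := by
  by_cases h : s = 0
  · simp [h, renyiTilde_zero hP]
  · rw [condRenyi, if_neg h]
    field_simp

lemma div_mul_condRenyi_sub (hP : P ∈ stdSimplex ℝ (A × E)) (R s : ℝ) :
    s / (1 + s) * (condRenyi P s - R) = (renyiTilde P s - s * R) / (1 + s) := by
  rw [div_mul_eq_mul_div, mul_condRenyi_sub hP]

/-- The extra 1 makes the alphabet size at least 2, so log M_n > 0 even when R = 0; the size stays
below 3e^{nR}. -/
lemma tendsto_log_ceil_exp_div {R : ℝ} (hR : 0 ≤ R) :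
    Tendsto (fun n : ℕ => Real.log ((⌈Real.exp (n * R)⌉₊ + 1 : ℕ) : ℝ) / n) atTop (𝓝 R) := by
  have hup : Tendsto (fun n : ℕ => Real.log 3 / n + R) atTop (𝓝 R) := by
    simpa using (tendsto_const_div_atTop_nhds_zero_nat (Real.log 3)).add_const R
  refine tendsto_of_tendsto_of_tendsto_of_le_of_le' tendsto_const_nhds hup ?_ ?_
  all_goals
    filter_upwards [eventually_gt_atTop 0] with n hn
    have hn0 : (0 : ℝ) < n := by exact_mod_cast hn
    have h1 := Nat.le_ceil (Real.exp (n * R))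
    have h2 := Nat.ceil_lt_add_one (Real.exp_pos (n * R)).le
    have h3 : 1 ≤ Real.exp (n * R) := Real.one_le_exp (by positivity)
    push_cast
  · rw [le_div_iff₀ hn0, mul_comm, Real.le_log_iff_exp_le (by positivity)]
    linarith
  · rw [div_add' _ _ _ hn0.ne']
    gcongr
    rw [mul_comm R, ← Real.log_exp (n * R), ← Real.log_mul (by norm_num) (Real.exp_pos _).ne',
      Real.log_exp]
    exact Real.log_le_log (by positivity) (by linarith)

lemma le_liminf_neg_log_div {I : ℕ → ℝ} {C v : ℝ} (hC : 0 < C)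
    (hI : ∀ n : ℕ, I n ≤ C * Real.exp (-(n * v))) :
    (v : EReal) ≤ liminf (fun n : ℕ => -ENNReal.log (ENNReal.ofReal (I n)) / (n : EReal)) atTop := by
  have hlim : Tendsto (fun n : ℕ => ((v - Real.log C / n : ℝ) : EReal)) atTop (𝓝 (v : EReal)) := by
    refine (continuous_coe_real_ereal.tendsto v).comp ?_
    simpa using (tendsto_const_div_atTop_nhds_zero_nat (Real.log C)).const_sub v
  rw [← hlim.liminf_eq]
  refine liminf_le_liminf ?_
  filter_upwards [eventually_gt_atTop 0] with n hn
  have hn0 : (n : ℝ) ≠ 0 := by exact_mod_cast hn.ne'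
  have h1 : ENNReal.log (ENNReal.ofReal (I n)) ≤ ((Real.log C - n * v : ℝ) : EReal) := by
    refine (ENNReal.log_le_log (ENNReal.ofReal_le_ofReal (hI n))).trans_eq ?_
    rw [ENNReal.log_ofReal_of_pos (by positivity), Real.log_mul hC.ne' (Real.exp_pos _).ne',
      Real.log_exp, sub_eq_add_neg]
  have h2 : (v - Real.log C / n : ℝ) = -(Real.log C - n * v) / n := by
    field_simp
    ring
  rw [h2, EReal.coe_div, EReal.coe_neg]
  exact EReal.div_le_div_right_of_nonneg (by simp) (EReal.neg_le_neg_iff.2 h1)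

/-- Random hashing attains the exponent given by the Rényi entropy of order `1 + s`. -/
lemma le_leakageExponent (hP : P ∈ stdSimplex ℝ (A × E)) {R s : ℝ} (hR : 0 ≤ R) (hs : 0 < s)
    (hs1 : s ≤ 1) (hv : 0 < renyiTilde P s - s * R) :
    ((renyiTilde P s - s * R : ℝ) : EReal) ≤ leakageExponent P R := by
  set v := renyiTilde P s - s * R with hvdef
  set M : ℕ → ℕ := fun n => ⌈Real.exp (n * R)⌉₊ + 1 with hM
  set C : ℝ := 3 ^ s / s with hC
  have hCpos : 0 < C := by positivity
  have hM2 : ∀ n, (2 : ℝ) ≤ M n := fun n => by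
    have h3 : 1 ≤ Real.exp (n * R) := Real.one_le_exp (by positivity)
    have := Nat.le_ceil (Real.exp (n * R))
    simp only [hM]; push_cast; linarith
  have hlogM : ∀ n, Real.log 2 ≤ Real.log (M n) := fun n =>
    Real.log_le_log two_pos (hM2 n)
  have hl2 := Real.log_pos one_lt_two
  choose f hf using fun n => exists_log_sub_condEntropy_le (iidDist_mem_stdSimplex hP n)
    (Nat.succ_pos ⌈Real.exp (n * R)⌉₊) hs hs1
  -- This one estimate yields both the leakage exponent and the asymptotic uniformity of the output.
  have hbound : ∀ n : ℕ, Real.log (M n) - condEntropy (hashDist (iidDist P n) (f n))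
      ≤ C * Real.exp (-(n * v)) := by
    intro n
    refine (hf n).trans ?_
    rw [sum_iidDist_mul_condProb_rpow hP]
    set Z := expMoment P (fun x => Real.log (condProb P x)) s
    have hZ : 0 < Z := expMoment_pos hP _ s
    have hM3 : ((⌈Real.exp (n * R)⌉₊ + 1 : ℕ) : ℝ) ≤ 3 * Real.exp (n * R) := by
      have h3 : 1 ≤ Real.exp (n * R) := Real.one_le_exp (by positivity)
      have := Nat.ceil_lt_add_one (Real.exp_pos (n * R)).le
      push_cast; linarith
    have hexp : Real.exp (-(n * v)) = Real.exp (n * R) ^ s * Z ^ n := by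
      rw [← Real.exp_mul, ← Real.exp_log hZ, ← Real.exp_nat_mul, ← Real.exp_add, hvdef,
        renyiTilde_eq hP hs.le]
      congr 1; ring
    calc _ ≤ (3 * Real.exp (n * R)) ^ s / s * Z ^ n := by gcongr
      _ = _ := by rw [Real.mul_rpow (by norm_num) (Real.exp_pos _).le, hexp, hC]; ring
  have hsimp : ∀ n, hashDist (iidDist P n) (f n) ∈ stdSimplex ℝ (Fin (M n) × (Fin n → E)) :=
    fun n => hashDist_mem_stdSimplex (iidDist_mem_stdSimplex hP n) (f n)
  refine (le_liminf_neg_log_div hCpos fun n => ?_).trans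
    (le_sSup ⟨M, f, R, tendsto_log_ceil_exp_div hR, le_rfl, ?_, rfl⟩)
  · exact (mutualInfo_hashDist_le (iidDist_mem_stdSimplex hP n) (f n)).trans (hbound n)
  · have hlim : Tendsto (fun n : ℕ => 1 - C * Real.exp (-(n * v)) / Real.log 2) atTop (𝓝 1) := by
      have h : Tendsto (fun n : ℕ => Real.exp (-(n * v))) atTop (𝓝 0) :=
        Real.tendsto_exp_neg_atTop_nhds_zero.comp
          (tendsto_natCast_atTop_atTop.atTop_mul_const hv)
      simpa using ((h.const_mul C).div_const (Real.log 2)).const_sub 1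
    refine tendsto_of_tendsto_of_tendsto_of_le_of_le hlim tendsto_const_nhds (fun n => ?_)
      fun n => ?_
    · have h1 := hbound n
      have h2 := condEntropy_le_entropy_margA (hsimp n)
      have h3 : 0 < Real.log (M n) := hl2.trans_le (hlogM n)
      have h4 : C * Real.exp (-(n * v)) / Real.log (M n) ≤ C * Real.exp (-(n * v)) / Real.log 2 :=
        div_le_div_of_nonneg_left (by positivity) hl2 (hlogM n)
      have h5 : 1 - C * Real.exp (-(n * v)) / Real.log (M n)
          ≤ entropy (margA (hashDist (iidDist P n) (f n))) / Real.log (M n) := by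
        rw [one_sub_div h3.ne']
        gcongr
        linarith
      exact (by linarith : _ ≤ 1 - C * Real.exp (-(n * v)) / Real.log (M n)).trans h5
    · exact (div_le_one (hl2.trans_le (hlogM n))).2
        (entropy_le_log_card (margA_mem_stdSimplex (hsimp n)))

end LeakageExponent

/-! ### Comparing the exponents W and V -/

section Comparison

variable {A E : Type*} [Fintype A] [Fintype E] {P : A × E → ℝ}

lemma exists_renyiTilde_sub_pos (hP : P ∈ stdSimplex ℝ (A × E)) {r : ℝ} (hr : r < condEntropy P) :
    ∃ s, 0 < s ∧ s ≤ 1 ∧ 0 < renyiTilde P s - s * r := by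
  obtain ⟨s, h0, h1, h2⟩ := exists_neg_log_expMoment_pos hP hr
  exact ⟨s, h0, h1, by rwa [renyiTilde_eq hP h0.le]⟩

lemma renyiTilde_sub_div_le (hP : P ∈ stdSimplex ℝ (A × E)) (R : ℝ) {s : ℝ} (hs : 0 ≤ s) :
    (renyiTilde P s - s * R) / (1 + s) ≤ renyiTilde P (s / (1 + s)) - s / (1 + s) * R := by
  have h := neg_log_expMoment_div_le hP (fun x => Real.log (condProb P x)) hs
  rw [← renyiTilde_eq hP hs, ← renyiTilde_eq hP (by positivity)] at h
  rw [sub_div, mul_div_right_comm]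
  linarith

lemma renyiTilde_sub_div_lt (hP : P ∈ stdSimplex ℝ (A × E)) (R : ℝ) {s : ℝ} (hs : 0 < s)
    {x y : A × E} (hx : 0 < P x) (hy : 0 < P y) (hxy : condProb P x ≠ condProb P y) :
    (renyiTilde P s - s * R) / (1 + s) < renyiTilde P (s / (1 + s)) - s / (1 + s) * R := by
  have h := neg_log_expMoment_div_lt hP (L := fun x => Real.log (condProb P x)) hs hx hy
    fun h => hxy (Real.log_injOn_pos (condProb_pos hP hx) (condProb_pos hP hy) h)
  rw [← renyiTilde_eq hP hs.le, ← renyiTilde_eq hP (by positivity)] at h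
  rw [sub_div, mul_div_right_comm]
  linarith

lemma div_one_add_mem_Icc {s : ℝ} (hs : 0 ≤ s) : s / (1 + s) ∈ Set.Icc (0 : ℝ) 1 :=
  ⟨by positivity, (div_le_one (by linarith)).2 (by linarith)⟩

lemma continuousOn_renyiTilde (hP : P ∈ stdSimplex ℝ (A × E)) :
    ContinuousOn (renyiTilde P) (Set.Ici 0) :=
  (continuous_neg_log_expMoment hP fun x => Real.log (condProb P x)).continuousOn.congr
    fun _ hs => renyiTilde_eq hP hs

/-- A uniform gap between the exponents obtained from the smooth min-entropy and from the Rényi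
entropies, for nonconstant conditional probabilities. -/
lemma exists_lt_forall_renyiTilde_sub_div_le (hP : P ∈ stdSimplex ℝ (A × E)) {R V : ℝ}
    (hV : ∀ s ∈ Set.Icc (0 : ℝ) 1, renyiTilde P s - s * R ≤ V) (hVpos : 0 < V)
    {x y : A × E} (hx : 0 < P x) (hy : 0 < P y) (hxy : condProb P x ≠ condProb P y) :
    ∃ w < V, ∀ s, 0 ≤ s → (renyiTilde P s - s * R) / (1 + s) ≤ w := by
  obtain ⟨k, C, hk, hlin⟩ := exists_neg_log_expMoment_le_linear hP
    (L := fun x => Real.log (condProb P x)) hx hy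
    fun h => hxy (Real.log_injOn_pos (condProb_pos hP hx) (condProb_pos hP hy) h)
  rw [← renyiTilde_eq hP zero_le_one] at hk
  have hkV : k - R < V := by linarith [hV 1 ⟨zero_le_one, le_rfl⟩]
  -- m is the midpoint between V and k - R, the slope left by the linear bound; S is the cutoff past
  -- which that bound keeps the quotient below m.
  set m := (k - R + V) / 2 with hm
  set S := |C - (k - R)| / (V - m) with hS
  have hVm : 0 < V - m := by rw [hm]; linarith
  have hS0 : 0 ≤ S := by positivity
  have hcont : ContinuousOn (fun s => (renyiTilde P s - s * R) / (1 + s)) (Set.Icc 0 S) := by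
    refine ContinuousOn.div (((continuousOn_renyiTilde hP).mono Set.Icc_subset_Ici_self).sub
      (by fun_prop)) (by fun_prop) fun s hs => ?_
    linarith [hs.1]
  obtain ⟨u, hu, hmax⟩ := isCompact_Icc.exists_isMaxOn (Set.nonempty_Icc.2 hS0) hcont
  have huV : (renyiTilde P u - u * R) / (1 + u) < V := by
    rcases hu.1.eq_or_lt with h | h
    · simpa [← h, renyiTilde_zero hP] using hVpos
    · exact (renyiTilde_sub_div_lt hP R h hx hy hxy).trans_le
        (hV _ (div_one_add_mem_Icc hu.1))
  refine ⟨max m ((renyiTilde P u - u * R) / (1 + u)), max_lt (by linarith) huV, fun s hs => ?_⟩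
  by_cases hsS : s ≤ S
  · exact (hmax ⟨hs, hsS⟩).trans (le_max_right _ _)
  · refine le_trans ?_ (le_max_left _ _)
    rw [not_le, hS, div_lt_iff₀ hVm] at hsS
    have h1 := hlin s
    rw [← renyiTilde_eq hP hs] at h1
    rw [div_le_iff₀ (by linarith)]
    have h2 := le_abs_self (C - (k - R))
    have h3 : V - m = m - (k - R) := by rw [hm]; ring
    rw [h3] at hsS hVm
    nlinarith

/-- At R' = R + t, with t the value of the quotient at s, both entries of the minimum reach t.
Conversely, if R' - R > W, then H̃_{1+s} - sR' ≤ W(1+s) - sW = W. The inner supremum can be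
infinite, hence `EReal`. -/
lemma coe_eq_iSup_min (hP : P ∈ stdSimplex ℝ (A × E)) {R W : ℝ}
    (hW : IsLUB ((fun s : ℝ => (renyiTilde P s - s * R) / (1 + s)) '' Set.Ici 0) W) :
    (W : EReal) = (⨆ (R' : ℝ) (_ : R ≤ R'),
      min (⨆ (s : ℝ) (_ : 0 ≤ s), ((renyiTilde P s - s * R' : ℝ) : EReal))
        ((R' - R : ℝ) : EReal)) := by
  apply le_antisymm
  · refine le_of_forall_lt fun c hc => ?_
    obtain ⟨w, hcw, hwW⟩ := EReal.lt_iff_exists_real_btwn.1 hc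
    obtain ⟨_, ⟨s, hs, rfl⟩, hws, -⟩ := hW.exists_between (EReal.coe_lt_coe_iff.1 hwW)
    have hs0 : (0 : ℝ) ≤ s := hs
    refine hcw.trans_le ((EReal.coe_le_coe_iff.2 hws.le).trans ?_)
    set t := (renyiTilde P s - s * R) / (1 + s) with ht
    have hts : t * (1 + s) = renyiTilde P s - s * R := div_mul_cancel₀ _ (by linarith)
    by_cases h0 : 0 ≤ t
    · refine le_iSup₂_of_le (R + t) (by linarith) (le_min ?_ ?_)
      · exact le_iSup₂_of_le s hs0 (EReal.coe_le_coe_iff.2 (by linarith))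
      · exact EReal.coe_le_coe_iff.2 (by linarith)
    -- A negative t is beaten by R' = R and s = 0, which give 0.
    · refine le_iSup₂_of_le R le_rfl (le_min ?_ ?_)
      · refine le_iSup₂_of_le 0 le_rfl (EReal.coe_le_coe_iff.2 ?_)
        rw [renyiTilde_zero hP]
        linarith
      · exact EReal.coe_le_coe_iff.2 (by linarith)
  · refine iSup₂_le fun R' _ => ?_
    by_cases h : R' - R ≤ W
    · exact (min_le_right _ _).trans (EReal.coe_le_coe_iff.2 h)
    · refine (min_le_left _ _).trans (iSup₂_le fun s hs => EReal.coe_le_coe_iff.2 ?_)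
      have h1 : _ ≤ W := hW.1 ⟨s, hs, rfl⟩
      rw [div_le_iff₀ (by linarith)] at h1
      nlinarith [mul_le_mul_of_nonneg_left (not_le.1 h).le hs]

lemma tendsto_neg_log_smoothLeakageBound (hP : P ∈ stdSimplex ℝ (A × E)) {R W : ℝ} (hR : 0 ≤ R)
    (hRH : R ≤ condEntropy P)
    (hW : IsLUB ((fun s : ℝ => (renyiTilde P s - s * R) / (1 + s)) '' Set.Ici 0) W) :
    Tendsto (fun n : ℕ =>
        -(1 / (n : ℝ)) * Real.log (smoothLeakageBound (iidDist P n) (Real.exp (n * R))))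
      atTop (𝓝 W) := by
  refine tendsto_neg_div_mul_log (fun δ hδ => ?_) fun δ hδ => ?_
  · refine eventually_exp_le_smoothLeakageBound hP hR (fun s hs => ?_) hδ
    exact (div_le_iff₀ (by linarith)).1 (hW.1 ⟨s, hs, rfl⟩)
  · suffices ∃ s r c, 0 ≤ s ∧ 0 < c ∧ c ≤ renyiTilde P s - s * r ∧ W - δ / 2 ≤ c ∧
        W - δ / 2 ≤ r - R by
      obtain ⟨s, r, c, hs, hc, hcr, h1, h2⟩ := this
      filter_upwards [eventually_smoothLeakageBound_le_exp hP hR hs hc hcr h1 h2 (half_pos hδ)]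
        with n hn
      rwa [sub_sub, add_halves] at hn
    -- The Chernoff exponent c must be positive. If W ≤ 0, lowering r to R - δ/2 < H(A|E) provides
    -- one; otherwise a near-optimal s with positive value does, at the balancing r.
    rcases le_or_gt W 0 with h | h
    · obtain ⟨s, hs, -, hpos⟩ := exists_renyiTilde_sub_pos hP (r := R - δ / 2) (by linarith)
      exact ⟨s, R - δ / 2, _, hs.le, hpos, le_rfl, by linarith, by linarith⟩
    · obtain ⟨_, ⟨s, hs, rfl⟩, hws, -⟩ :=
        hW.exists_between (max_lt h (by linarith : W - δ / 2 < W))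
      obtain ⟨h1, h2⟩ := max_lt_iff.1 hws
      have hs0 : (0 : ℝ) ≤ s := hs
      have hts : (renyiTilde P s - s * R) / (1 + s) * (1 + s) = renyiTilde P s - s * R :=
        div_mul_cancel₀ _ (by linarith)
      exact ⟨s, R + (renyiTilde P s - s * R) / (1 + s), _, hs, h1, by linarith, h2.le,
        by linarith⟩

end Comparison

end SmoothMinEntropy

open SmoothMinEntropy in
theorem mainTheorem10 {A E : Type*} [Fintype A] [DecidableEq A] [Fintype E]
    (P : A × E → ℝ) (hP : P ∈ stdSimplex ℝ (A × E)) :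
    (∀ (M : ℕ) (q : (A → Fin M) → ℝ), IsUniversalTwo q →
      expectedLeakage P q ≤ smoothLeakageBound P M) ∧
    ∀ R : ℝ, 0 ≤ R → R ≤ condEntropy P →
      ∃ W V : ℝ,
        IsLUB ((fun s : ℝ => s / (1 + s) * (condRenyi P s - R)) '' Set.Ici 0) W ∧
        IsGreatest ((fun s : ℝ => s * (condRenyi P s - R)) '' Set.Icc 0 1) V ∧
        Tendsto (fun n : ℕ =>
            -(1 / (n : ℝ)) * Real.log (smoothLeakageBound (iidDist P n) (Real.exp (n * R))))
          atTop (𝓝 W) ∧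
        (W : EReal) = (⨆ (R' : ℝ) (_ : R ≤ R'),
          min (⨆ (s : ℝ) (_ : 0 ≤ s), ((renyiTilde P s - s * R' : ℝ) : EReal))
            ((R' - R : ℝ) : EReal)) ∧
        (R < condEntropy P → (W : EReal) ≤ leakageExponent P R) ∧
        W ≤ V ∧
        (R < condEntropy P →
          (∃ x y : A × E, 0 < P x ∧ 0 < P y ∧ condProb P x ≠ condProb P y) → W < V) := by
  refine ⟨fun M q hq => expectedLeakage_le_smoothLeakageBound hP hq, fun R hR hRH => ?_⟩
  simp only [div_mul_condRenyi_sub hP, mul_condRenyi_sub hP]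
  obtain ⟨u, hu, hmax⟩ := isCompact_Icc.exists_isMaxOn
    (Set.nonempty_Icc.2 (zero_le_one (α := ℝ)))
    (((continuousOn_renyiTilde hP).mono Set.Icc_subset_Ici_self).sub
      (continuous_id.mul continuous_const).continuousOn :
      ContinuousOn (fun s => renyiTilde P s - s * R) (Set.Icc 0 1))
  set V := renyiTilde P u - u * R with hV
  have hVle : ∀ s ∈ Set.Icc (0 : ℝ) 1, renyiTilde P s - s * R ≤ V := fun s hs => hmax hs
  have hub : V ∈ upperBounds ((fun s : ℝ => (renyiTilde P s - s * R) / (1 + s)) '' Set.Ici 0) := by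
    rintro _ ⟨s, hs, rfl⟩
    exact (renyiTilde_sub_div_le hP R hs).trans (hVle _ (div_one_add_mem_Icc hs))
  have hVpos : R < condEntropy P → 0 < V := fun h => by
    obtain ⟨s, h0, h1, h2⟩ := exists_renyiTilde_sub_pos hP h
    exact h2.trans_le (hVle s ⟨h0.le, h1⟩)
  have hW := isLUB_csSup (Set.nonempty_Ici.image
    fun s : ℝ => (renyiTilde P s - s * R) / (1 + s)) ⟨V, hub⟩
  refine ⟨_, V, hW, ⟨⟨u, hu, rfl⟩, ?_⟩, tendsto_neg_log_smoothLeakageBound hP hR hRH hW,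
    coe_eq_iSup_min hP hW, fun h => ?_, hW.2 hub, ?_⟩
  · rintro _ ⟨s, hs, rfl⟩
    exact hVle s hs
  -- V > 0 excludes the maximiser u = 0, so hashing at order 1 + u attains V.
  · have hu0 : 0 < u := hu.1.lt_of_ne' fun h0 => by
      have := hVpos h
      simp [hV, h0, renyiTilde_zero hP] at this
    exact (EReal.coe_le_coe_iff.2 (hW.2 hub)).trans
      (le_leakageExponent hP hR hu0 hu.2 (hVpos h))
  · rintro h ⟨x, y, hx, hy, hxy⟩
    obtain ⟨w, hwV, hw⟩ := exists_lt_forall_renyiTilde_sub_div_le hP hVle (hVpos h) hx hy hxy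
    refine (hW.2 ?_).trans_lt hwV
    rintro _ ⟨s, hs, rfl⟩
    exact hw s hs
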